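/- Let $\mathbb{S}$ be the set of all strictly decreasing sequences $s=\langle s_n : n\ge 1\rangle$ of positive reals converging to $0$. For $s\in\mathbb{S}$ let $s^*=\{\langle s_{kn}:n\ge1\rangle : k\ge 1\}$ be the set of all multiplicative shifts of $s$. For $S\subseteq\mathbb{S}$ let $\mathcal{D}(S)$ be the family of all sets $E\subseteq\mathbb{R}$ such that for every $t\in S$ there is a sequence $\langle E_n : n\ge1\rangle$ of subsets of $\mathbb{R}$ with $E\subseteq\bigcup_{n\ge1}E_n$ and $\operatorname{diam}E_n<t_n$ for all $n$. For real $\alpha\ge0$ let $\mathrm{HD}(\alpha)$ be the family of all $E\subseteq\mathbb{R}$ of Hausdorff dimension at most $\alpha$. Then: (i) For every $s\in\mathbb{S}$ and every real $\alpha$ with $0\le\alpha<1$, $\mathrm{HD}(\alpha)\neq\mathcal{D}(s^*)$. (ii) For every $s\in\mathbb{S}$, $\mathrm{HD}(1)\neq\mathcal{D}(s^*)$ if and only if $s\in\ell^1$, that is, $\sum_{n\ge1}s_n<\infty$. -/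

import Mathlib

open Set Filter Topology
open scoped NNReal ENNReal

namespace Dominated

/-- The family `𝕊` of all strictly decreasing sequences of positive reals, indexed by the positive
integers, that converge to `0`. -/
def decSeq : Set (ℕ+ → ℝ) :=
  {s | StrictAnti s ∧ (∀ n, 0 < s n) ∧ Tendsto s atTop (𝓝 0)}

/-- The multiplicative `k`-shift `⟨s_{kn} : n ∈ ℕ₊⟩` of a sequence `s`. -/
def mulShift (s : ℕ+ → ℝ) (k : ℕ+) : ℕ+ → ℝ := fun n => s (k * n)

/-- The closure `S*` of a family of sequences: all multiplicative shifts of its members. -/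
def mulClosure (S : Set (ℕ+ → ℝ)) : Set (ℕ+ → ℝ) :=
  {t | ∃ s ∈ S, ∃ k : ℕ+, t = mulShift s k}

/-- A sequence of sets is `s`-fine if `diam Eₙ < sₙ` for all `n`; the diameter is the extended
one, so that unbounded sets have infinite diameter. -/
def IsFine {X : Type*} [MetricSpace X] (s : ℕ+ → ℝ) (E : ℕ+ → Set X) : Prop :=
  ∀ n, Metric.ediam (E n) < ENNReal.ofReal (s n)

/-- `A` is `S`-dominated if for each `s ∈ S` there is an `s`-fine cover of `A`. -/
def IsDominated {X : Type*} [MetricSpace X] (S : Set (ℕ+ → ℝ)) (A : Set X) : Prop :=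
  ∀ s ∈ S, ∃ E : ℕ+ → Set X, IsFine s E ∧ A ⊆ ⋃ n, E n

/-- The family `𝒟_X(S)` of all `S`-dominated subsets of `X`. -/
def dominatedSets (X : Type*) [MetricSpace X] (S : Set (ℕ+ → ℝ)) : Set (Set X) :=
  {A | IsDominated S A}

/-- The family of all subsets of the real line of Hausdorff dimension at most `α`. -/
def hausdorffDimLE (α : ℝ≥0) : Set (Set ℝ) := {A | dimH A ≤ (α : ℝ≥0∞)}

end Dominated

/-!
Given `a : ℕ → ℕ` whose steps are `0` or `1`, spread the binary digits of the points of `[0, 1)` by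
writing them only at the places where `a` jumps. The resulting Cantor set meets `2 ^ a m` dyadic
intervals of length `2 ^ (-m)`, each of mass `2 ^ (-a m)` for the spread Lebesgue measure. Let `m n`
be the dyadic scale of `s n`. If `∑ 2 ^ (-a (m n))` diverges, then so does the sum along the
multiples of any `k`, and covering greedily from left to right shows that the Cantor set is
dominated. If the sum converges, then its tails bound the spread measure of a dominated set, because
the shift by `k` only sees indices at least `k`; so the Cantor set is not dominated.

Fix `α < 1`. If `∑ s n ^ β` diverges for some `β ∈ (α, 1]`, taking `2 ^ (-a m)` comparable to
`2 ^ (-β * m)` gives a dominated set of dimension at least `β > α`. Otherwise choose exponents `β j`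
decreasing to `α` and weights `c j` so small that the gauge `w m = ∑ j, c j * 2 ^ (-β j * m)` still
has `∑ w (m n) < ∞`; taking `2 ^ (-a m)` comparable to `w m` gives a set of dimension at most `α`
that is not dominated.

For `α = 1` the same dichotomy applies to the line itself with Lebesgue measure: if `∑ s n`
diverges, both half-lines are covered greedily, and if it converges, dominated sets are null.
-/

namespace Dominated

open MeasureTheory

theorem exists_sum_Iio_le_lt_sum_Iic {ι : Type*} [LinearOrder ι] [LocallyFiniteOrderBot ι]
    [WellFoundedLT ι] {u : ι → ℝ} (hu : 0 ≤ u) (hns : ¬ Summable u) {x : ℝ} (hx : 0 ≤ x) :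
    ∃ n, ∑ i ∈ Finset.Iio n, u i ≤ x ∧ x < ∑ i ∈ Finset.Iic n, u i := by
  have sum_le_of_subset {n : ι} {T : Finset ι} (hT : ∀ i ∈ T, i ≤ n) :
      ∑ i ∈ T, u i ≤ ∑ i ∈ Finset.Iic n, u i :=
    Finset.sum_le_sum_of_subset_of_nonneg (fun i hi => Finset.mem_Iic.2 (hT i hi))
      fun i _ _ => hu i
  have exceeded : {n | x < ∑ i ∈ Finset.Iic n, u i}.Nonempty := by
    by_contra! hempty
    refine hns (summable_of_sum_le (c := x) hu fun T => ?_)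
    rcases T.eq_empty_or_nonempty with rfl | hT
    · simpa using hx
    · exact (sum_le_of_subset (T.le_max' ·)).trans
        (not_lt.1 (eq_empty_iff_forall_notMem.1 hempty (T.max' hT)))
  obtain ⟨n, hn, hmin⟩ := WellFounded.has_min wellFounded_lt _ exceeded
  refine ⟨n, ?_, hn⟩
  rcases (Finset.Iio n).eq_empty_or_nonempty with hI | hI
  · simpa [hI] using hx
  · exact (sum_le_of_subset ((Finset.Iio n).le_max' ·)).trans
      (not_lt.1 fun h => hmin _ h (Finset.mem_Iio.1 (Finset.max'_mem _ hI)))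

theorem summable_of_summable_mul_left {f : ℕ+ → ℝ} (hf : Antitone f) (k : ℕ+)
    (h : Summable fun n => f (k * n)) : Summable f := by
  have : NeZero (k : ℕ) := ⟨k.ne_zero⟩
  have hg : Antitone fun n : ℕ => f n.succPNat := fun _ _ hmn =>
    hf (Nat.succPNat_le_succPNat.2 hmn)
  have hi : Function.Injective fun n : ℕ+ => (k * n).natPred :=
    PNat.natPred_injective.comp (mul_right_injective k)
  rw [← Equiv.pnatEquivNat.symm.summable_iff]
  refine (summable_indicator_mod_iff hg (-1 : ZMod k)).1 ((hi.summable_iff fun n hn => ?_).1 ?_)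
  · refine indicator_of_notMem (fun hmod => hn ?_) _
    have hdvd : (k : ℕ) ∣ n + 1 := by
      rw [← ZMod.natCast_eq_zero_iff, Nat.cast_add_one, show (n : ZMod k) = -1 from hmod,
        neg_add_cancel]
    obtain ⟨j, hj⟩ := PNat.dvd_iff.2 (show (k : ℕ) ∣ (n.succPNat : ℕ) from hdvd)
    exact ⟨j, by simp only [← hj, Nat.natPred_succPNat]⟩
  · refine h.congr fun n => ?_
    have hmod : ((k * n).natPred : ZMod k) = -1 := by
      rw [eq_neg_iff_add_eq_zero, ← Nat.cast_add_one, PNat.natPred_add_one, PNat.mul_coe,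
        Nat.cast_mul, ZMod.natCast_self, zero_mul]
    simp [indicator, hmod]

theorem exists_pos_summable_mul_prod {ι : Type*} {f : ℕ → ι → ℝ} (h0 : ∀ j, 0 ≤ f j)
    (hf : ∀ j, Summable (f j)) :
    ∃ c : ℕ → ℝ, (∀ j, 0 < c j) ∧ Summable c ∧ Summable fun p : ℕ × ι => c p.1 * f p.1 p.2 := by
  have htsum (j) : 0 ≤ ∑' n, f j n := tsum_nonneg (h0 j)
  obtain ⟨c, hc, hc_le, hc_mul_le⟩ : ∃ c : ℕ → ℝ, (∀ j, 0 < c j) ∧ (∀ j, c j ≤ (1 / 2) ^ j) ∧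
      ∀ j, c j * ∑' n, f j n ≤ (1 / 2) ^ j := by
    refine ⟨fun j => (1 / 2) ^ j / (1 + ∑' n, f j n),
      fun j => div_pos (by positivity) (by linarith [htsum j]),
      fun j => div_le_self (by positivity) (le_add_of_nonneg_right (htsum j)), fun j => ?_⟩
    rw [div_mul_eq_mul_div]
    exact div_le_of_le_mul₀ (add_nonneg zero_le_one (htsum j)) (by positivity)
      (mul_le_mul_of_nonneg_left (le_add_of_nonneg_left zero_le_one) (by positivity))
  have hsum : Summable c := .of_nonneg_of_le (fun j => (hc j).le) hc_le summable_geometric_two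
  have hnonneg : 0 ≤ fun p : ℕ × ι => c p.1 * f p.1 p.2 := fun p =>
    mul_nonneg (hc p.1).le (h0 p.1 p.2)
  have hsum_tsum : Summable fun j => ∑' n, c j * f j n := by
    simp only [tsum_mul_left]
    exact .of_nonneg_of_le (fun j => mul_nonneg (hc j).le (htsum j)) hc_mul_le
      summable_geometric_two
  exact ⟨c, hc, hsum, (summable_prod_of_nonneg hnonneg).2
    ⟨fun j => (hf j).mul_left (c j), hsum_tsum⟩⟩

theorem dimH_le_of_forall_finite_cover {X : Type*} [EMetricSpace X] {A : Set X} {ι : ℕ → Type*}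
    [∀ m, Fintype (ι m)] {t : ∀ m, ι m → Set X} {r : ℕ → ℝ≥0∞} (hr : Tendsto r atTop (𝓝 0))
    (ht : ∀ m i, Metric.ediam (t m i) ≤ r m) (hA : ∀ m, A ⊆ ⋃ i, t m i) {d C : ℝ≥0}
    (hC : ∀ m, Fintype.card (ι m) * r m ^ (d : ℝ) ≤ C) : dimH A ≤ d := by
  borelize X
  refine dimH_le_of_hausdorffMeasure_ne_top (ne_top_of_le_ne_top (b := C) ENNReal.coe_ne_top ?_)
  refine (Measure.hausdorffMeasure_le_liminf_sum d A r hr t (.of_forall ht) (.of_forall hA)).trans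
    (liminf_le_of_le (by isBoundedDefault) fun b hb => ?_)
  obtain ⟨m, hm⟩ := hb.exists
  calc b ≤ ∑ i, Metric.ediam (t m i) ^ (d : ℝ) := hm
    _ ≤ ∑ _i : ι m, r m ^ (d : ℝ) :=
      Finset.sum_le_sum fun i _ => ENNReal.rpow_le_rpow (ht m i) d.coe_nonneg
    _ = Fintype.card (ι m) * r m ^ (d : ℝ) := by
      rw [Finset.sum_const, Finset.card_univ, nsmul_eq_mul]
    _ ≤ C := hC m

theorem dimH_le_dimH_image_div {X Y : Type*} [EMetricSpace X] [EMetricSpace Y] {f : X → Y}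
    {A : Set X} {C r : ℝ≥0} (hr : 0 < r)
    (hf : ∀ x ∈ A, ∀ y ∈ A, edist x y ≤ C * edist (f x) (f y) ^ (r : ℝ)) :
    dimH A ≤ dimH (f '' A) / r := by
  rcases A.eq_empty_or_nonempty with rfl | ⟨x₀, -⟩
  · simp
  have : Nonempty X := ⟨x₀⟩
  have hinj : InjOn f A := fun x hx y hy hxy => by
    simpa [hxy, ENNReal.zero_rpow_of_pos (NNReal.coe_pos.2 hr)] using hf x hx y hy
  have hinv : HolderOnWith C r (Function.invFunOn f A) (f '' A) := by
    rintro _ ⟨x, hx, rfl⟩ _ ⟨y, hy, rfl⟩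
    rw [hinj.leftInvOn_invFunOn hx, hinj.leftInvOn_invFunOn hy]
    exact hf x hx y hy
  simpa [hinj.leftInvOn_invFunOn.image_image] using hinv.dimH_image_le hr

theorem exists_isFine_cover_of_injective {X ι : Type*} [MetricSpace X] {e : ι → ℕ+}
    (he : Function.Injective e) {t : ℕ+ → ℝ} (ht : ∀ n, 0 < t n) {E : ι → Set X}
    (hE : ∀ i, Metric.ediam (E i) < ENNReal.ofReal (t (e i))) :
    ∃ F : ℕ+ → Set X, IsFine t F ∧ ⋃ i, E i ⊆ ⋃ n, F n := by
  refine ⟨Function.extend e E fun _ => ∅, fun n => ?_, iUnion_subset fun i => ?_⟩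
  · by_cases hn : ∃ i, e i = n
    · obtain ⟨i, rfl⟩ := hn
      simpa only [he.extend_apply] using hE i
    · simpa only [Function.extend_apply' _ _ _ hn, Metric.ediam_empty, ENNReal.ofReal_pos]
        using ht n
  · exact subset_iUnion_of_subset (e i) (he.extend_apply _ _ i).ge

theorem IsDominated.union {X : Type*} [MetricSpace X] {S : Set (ℕ+ → ℝ)}
    (hS : ∀ s ∈ S, Antitone s) {A B : Set X} (hA : IsDominated (mulClosure S) A)
    (hB : IsDominated (mulClosure S) B) : IsDominated (mulClosure S) (A ∪ B) := by
  rintro _ ⟨s, hs, k, rfl⟩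
  obtain ⟨E, hE, hAE⟩ := hA _ ⟨s, hs, k * 2, rfl⟩
  obtain ⟨F, hF, hBF⟩ := hB _ ⟨s, hs, k * 2, rfl⟩
  have hpos (n) : 0 < mulShift s k n :=
    (ENNReal.ofReal_pos.1 (zero_le.trans_lt (hE n))).trans_le
      (hS s hs (mul_le_mul_left (le_mul_of_one_le_right' one_le) n))
  -- Place the `j`-th sets of the two covers at the indices `2 * j` and `2 * j - 1`: by monotonicity
  -- both obey the bound `s (k * 2 * j)` there.
  let odd (j : ℕ+) : ℕ+ := (2 * j.natPred).succPNat
  have odd_add_one (j) : (odd j : ℕ) + 1 = 2 * j := by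
    have := j.natPred_add_one
    simp only [odd, Nat.succPNat_coe]
    omega
  let e : ℕ+ ⊕ ℕ+ → ℕ+ := Sum.elim (2 * ·) odd
  have he : Function.Injective e := by
    refine (mul_right_injective 2).sumElim (fun i j hij => ?_) fun i j hij => ?_
    · have := odd_add_one i
      have := odd_add_one j
      grind [PNat.coe_inj]
    · have := odd_add_one j
      rw [← PNat.coe_inj, PNat.mul_coe, PNat.val_ofNat] at hij
      omega
  have he_le (p) : e p ≤ 2 * p.elim id id := by
    rcases p with j | j
    · exact le_rfl
    · rw [← PNat.coe_le_coe, PNat.mul_coe, PNat.val_ofNat]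
      exact (Nat.le_succ _).trans_eq (odd_add_one j)
  obtain ⟨G, hG, hEFG⟩ := exists_isFine_cover_of_injective he hpos (E := Sum.elim E F) fun p => by
    refine lt_of_lt_of_le ?_ (ENNReal.ofReal_le_ofReal (hS s hs (mul_le_mul_right (he_le p) k)))
    rw [← mul_assoc]
    exact p.casesOn hE hF
  rw [iUnion_sumElim, union_subset_iff] at hEFG
  exact ⟨G, hG, union_subset (hAE.trans hEFG.1) (hBF.trans hEFG.2)⟩

theorem IsDominated.outerMeasure_eq_zero {X : Type*} [MetricSpace X] {M : Type*}
    [FunLike M (Set X) ℝ≥0∞] [OuterMeasureClass M X] (μ : M) {s : ℕ+ → ℝ} {r : ℕ+ → ℝ≥0∞}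
    (hr : ∑' n, r n ≠ ⊤)
    (hμ : ∀ᶠ n in cofinite, ∀ E, Metric.ediam E < ENNReal.ofReal (s n) → μ E ≤ r n)
    {A : Set X} (hA : IsDominated (mulClosure {s}) A) : μ A = 0 := by
  refine nonpos_iff_eq_zero.1 (le_of_forall_gt fun ε hε => ?_)
  obtain ⟨T, htail, hT⟩ := (((ENNReal.tendsto_tsum_compl_atTop_zero hr).eventually
    (gt_mem_nhds hε)).and (eventually_ge_atTop (eventually_cofinite.1 hμ).toFinset)).exists
  obtain ⟨N, hN⟩ := T.bddAbove
  have shift_notMem (n : ℕ+) : (N + 1) * n ∉ T := fun hn =>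
    ((PNat.lt_add_right N 1).trans_le (le_mul_of_one_le_right' (one_le : 1 ≤ n))).not_ge (hN hn)
  -- The multiples of `N + 1` avoid `T ⊆ [1, N]`, so this shift of `s` only uses the tail of `r`.
  obtain ⟨E, hE, hAE⟩ := hA _ ⟨s, rfl, N + 1, rfl⟩
  have hμE (n) : μ (E n) ≤ r ((N + 1) * n) := by
    by_contra hn
    exact shift_notMem n (hT (by simpa using ⟨E n, hE n, not_le.1 hn⟩))
  calc μ A ≤ ∑' n, μ (E n) := (measure_mono hAE).trans (measure_iUnion_le E)
    _ ≤ ∑' n, r ((N + 1) * n) := ENNReal.tsum_le_tsum hμE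
    _ ≤ ∑' n : {n // n ∉ T}, r n :=
      ENNReal.tsum_comp_le_tsum_of_injective
        (f := fun n => (⟨(N + 1) * n, shift_notMem n⟩ : {n // n ∉ T}))
        (fun _ _ h => mul_left_cancel (Subtype.ext_iff.1 h)) fun n => r n
    _ < ε := htail

theorem exists_isFine_cover_image_Ici {X : Type*} [MetricSpace X] {f : ℝ → X} {t u : ℕ+ → ℝ}
    (hu : 0 ≤ u) (hns : ¬ Summable u)
    (hf : ∀ n, Metric.ediam (f '' Ico (∑ i ∈ Finset.Iio n, u i) (∑ i ∈ Finset.Iic n, u i)) <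
      ENNReal.ofReal (t n)) :
    ∃ E : ℕ+ → Set X, IsFine t E ∧ f '' Ici 0 ⊆ ⋃ n, E n := by
  refine ⟨_, hf, ?_⟩
  rintro _ ⟨x, hx, rfl⟩
  obtain ⟨n, hn⟩ := exists_sum_Iio_le_lt_sum_Iic hu hns hx
  exact mem_iUnion.2 ⟨n, mem_image_of_mem f hn⟩

theorem isDominated_image_Ici {X : Type*} [MetricSpace X] {f : ℝ → X}
    (hf : LipschitzWith 1 f) {s : ℕ+ → ℝ} (hs : Antitone s) (hpos : ∀ n, 0 < s n)
    (hns : ¬ Summable s) : IsDominated (mulClosure {s}) (f '' Ici 0) := by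
  rintro _ ⟨s, rfl, k, rfl⟩
  have hns' : ¬ Summable fun n : ℕ+ => s (k * n) / 2 := fun h =>
    hns (summable_of_summable_mul_left hs k ((summable_div_const_iff two_ne_zero).1 h))
  refine exists_isFine_cover_image_Ici (fun n => (half_pos (hpos _)).le) hns' fun n => ?_
  refine (hf.ediam_image_le _).trans_lt ?_
  rw [ENNReal.coe_one, one_mul, Real.ediam_Ico, ← Finset.Iio_insert,
    Finset.sum_insert Finset.notMem_Iio_self, add_sub_cancel_right]
  exact (ENNReal.ofReal_lt_ofReal_iff (hpos _)).2 (half_lt_self (hpos _))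

theorem isDominated_of_not_summable {s : ℕ+ → ℝ} (hs : Antitone s) (hpos : ∀ n, 0 < s n)
    (hns : ¬ Summable s) (A : Set ℝ) : IsDominated (mulClosure {s}) A := by
  have hIci := isDominated_image_Ici LipschitzWith.id hs hpos hns
  have hIic := isDominated_image_Ici (IsometryEquiv.neg ℝ).isometry.lipschitz hs hpos hns
  have huniv := hIci.union (by simpa using hs) hIic
  rintro t ht
  obtain ⟨E, hE, hcover⟩ := huniv t ht
  exact ⟨E, hE, fun x _ => hcover (by simp)⟩

theorem volume_eq_zero_of_isDominated {s : ℕ+ → ℝ} (hsum : Summable s) {A : Set ℝ}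
    (hA : IsDominated (mulClosure {s}) A) : volume A = 0 :=
  hA.outerMeasure_eq_zero volume hsum.tsum_ofReal_ne_top
    (.of_forall fun _ E hE => (Real.volume_le_diam E).trans hE.le)

/-! ### Dyadic scales -/

/-- The order of magnitude of `r ∈ (0, 1]` on the dyadic scale: `2 ^ (-(m + 1)) < r ≤ 2 ^ (-m)` for
`m = dyadicScale r`. It is `0` for `r > 1`. -/
noncomputable def dyadicScale (r : ℝ) : ℕ := ⌊-Real.logb 2 r⌋₊

theorem dyadicScale_le_dyadicScale {r r' : ℝ} (hr : 0 < r) (h : r ≤ r') :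
    dyadicScale r' ≤ dyadicScale r :=
  Nat.floor_mono (neg_le_neg (Real.logb_le_logb_of_le one_lt_two hr h))

theorem dyadicScale_le_dyadicScale_add_one {r r' : ℝ} (hr : 0 < r) (hr' : 0 < r')
    (h : r ≤ 2 * r') : dyadicScale r' ≤ dyadicScale r + 1 := by
  have hlog : Real.logb 2 r ≤ 1 + Real.logb 2 r' := by
    rw [← Real.logb_self_eq_one one_lt_two, ← Real.logb_mul two_ne_zero hr'.ne']
    exact Real.logb_le_logb_of_le one_lt_two hr h
  have hfloor : -Real.logb 2 r < dyadicScale r + 1 := Nat.lt_floor_add_one _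
  rw [← Nat.lt_succ_iff, dyadicScale, Nat.floor_lt' (Nat.succ_ne_zero _)]
  push_cast
  linarith

theorem inv_two_pow_dyadicScale_add_one_lt {r : ℝ} (hr : 0 < r) :
    ((2 : ℝ) ^ (dyadicScale r + 1))⁻¹ < r := by
  rw [← Real.rpow_natCast, ← Real.rpow_neg zero_le_two, ← Real.lt_logb_iff_rpow_lt one_lt_two hr,
    neg_lt, Nat.cast_add_one]
  exact Nat.lt_floor_add_one _

theorem le_inv_two_pow_dyadicScale {r : ℝ} (hr : 0 < r) (hr1 : r ≤ 1) :
    r ≤ ((2 : ℝ) ^ dyadicScale r)⁻¹ := by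
  rw [← Real.rpow_natCast, ← Real.rpow_neg zero_le_two, ← Real.logb_le_iff_le_rpow one_lt_two hr,
    le_neg]
  exact Nat.floor_le (neg_nonneg.2 (Real.logb_nonpos one_lt_two hr.le hr1))

theorem dyadicScale_eq_zero {r : ℝ} (hr : 1 ≤ r) : dyadicScale r = 0 :=
  Nat.floor_of_nonpos (neg_nonpos.2 (Real.logb_nonneg one_lt_two hr))

theorem eventually_le_one_of_summable_dyadicScale {ι : Type*} {s : ι → ℝ} {g : ℕ → ℝ}
    (hg : g 0 ≠ 0) (h : Summable fun n => g (dyadicScale (s n))) :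
    ∀ᶠ n in cofinite, s n ≤ 1 := by
  filter_upwards [h.tendsto_cofinite_zero.eventually_ne hg.symm] with n hn
  contrapose! hn
  rw [dyadicScale_eq_zero hn.le]

theorem summable_rpow_dyadicScale_iff {ι : Type*} {s : ι → ℝ} (hpos : ∀ n, 0 < s n) {β : ℝ}
    (hβ : 0 ≤ β) :
    (Summable fun n => ((2 : ℝ) ^ dyadicScale (s n))⁻¹ ^ β) ↔ Summable fun n => s n ^ β := by
  constructor
  · intro h
    refine h.of_norm_bounded_eventually ?_
    filter_upwards [eventually_le_one_of_summable_dyadicScale (g := fun m => ((2 : ℝ) ^ m)⁻¹ ^ β)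
      (by simp) h] with n hn
    rw [Real.norm_of_nonneg (Real.rpow_nonneg (hpos n).le β)]
    exact Real.rpow_le_rpow (hpos n).le (le_inv_two_pow_dyadicScale (hpos n) hn) hβ
  · intro h
    refine .of_nonneg_of_le (fun n => by positivity) (fun n => ?_) (h.mul_left (2 ^ β))
    rw [← Real.mul_rpow zero_le_two (hpos n).le]
    refine Real.rpow_le_rpow (by positivity) ?_ hβ
    have := inv_two_pow_dyadicScale_add_one_lt (hpos n)
    rw [pow_succ, mul_inv] at this
    linarith

theorem inv_two_pow_rpow_antitone {β : ℝ} (hβ : 0 ≤ β) :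
    Antitone fun m : ℕ => ((2 : ℝ) ^ m)⁻¹ ^ β := fun m n hmn => by
  dsimp only
  gcongr
  exact one_le_two

theorem inv_two_pow_rpow_le_two_mul {β : ℝ} (hβ : β ≤ 1) (m : ℕ) :
    ((2 : ℝ) ^ m)⁻¹ ^ β ≤ 2 * ((2 : ℝ) ^ (m + 1))⁻¹ ^ β := by
  have hhalf : (2 : ℝ)⁻¹ ≤ 2⁻¹ ^ β := by
    simpa using Real.rpow_le_rpow_of_exponent_ge (x := (2 : ℝ)⁻¹) (by norm_num) (by norm_num) hβ
  rw [pow_succ, mul_inv, Real.mul_rpow (by positivity) (by positivity), mul_left_comm]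
  exact le_mul_of_one_le_right (by positivity) (by linarith)

theorem le_mul_rpow_of_forall_dyadic {D d : ℝ} {C β : ℝ≥0} (hβ : 0 < β) (hd : 0 ≤ d) (hD : D ≤ 1)
    (h : ∀ m : ℕ, d ≤ ((2 : ℝ) ^ m)⁻¹ → D ≤ C * ((2 : ℝ) ^ m)⁻¹ ^ (β : ℝ)) :
    D ≤ (C * 2 ^ (β : ℝ) + 1) * d ^ (β : ℝ) := by
  rcases hd.eq_or_lt with rfl | hd
  · have hlim : Tendsto (fun m : ℕ => C * ((2 : ℝ) ^ m)⁻¹ ^ (β : ℝ)) atTop (𝓝 0) := by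
      have := ((tendsto_pow_atTop_nhds_zero_of_lt_one (r := (2 : ℝ)⁻¹) (by norm_num)
        (by norm_num)).rpow_const (Or.inr β.coe_nonneg)).const_mul (C : ℝ)
      simpa [Real.zero_rpow (NNReal.coe_pos.2 hβ).ne'] using this
    simpa [Real.zero_rpow (NNReal.coe_pos.2 hβ).ne'] using
      ge_of_tendsto' hlim fun m => h m (by positivity)
  rw [add_mul, one_mul, mul_assoc, ← Real.mul_rpow zero_le_two hd.le]
  rcases le_total d 1 with hd1 | hd1
  · calc D ≤ C * ((2 : ℝ) ^ dyadicScale d)⁻¹ ^ (β : ℝ) := h _ (le_inv_two_pow_dyadicScale hd hd1)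
      _ ≤ C * (2 * d) ^ (β : ℝ) := by
        gcongr
        have := inv_two_pow_dyadicScale_add_one_lt hd
        rw [pow_succ, mul_inv] at this
        linarith
      _ ≤ C * (2 * d) ^ (β : ℝ) + d ^ (β : ℝ) := le_add_of_nonneg_right (by positivity)
  · calc D ≤ d ^ (β : ℝ) := hD.trans (Real.one_le_rpow hd1 β.coe_nonneg)
      _ ≤ C * (2 * d) ^ (β : ℝ) + d ^ (β : ℝ) := le_add_of_nonneg_left (by positivity)

/-- A sequence of naturals each of whose steps is `0` or `1`. For the spreading along `a`, the
steps equal to `1` mark the binary places that carry digits. -/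
def UnitSteps (a : ℕ → ℕ) : Prop := ∀ m, a (m + 1) = a m ∨ a (m + 1) = a m + 1

theorem UnitSteps.monotone {a : ℕ → ℕ} (ha : UnitSteps a) : Monotone a :=
  monotone_nat_of_le_succ fun m => by rcases ha m with h | h <;> omega

theorem UnitSteps.inv_two_pow_le {a : ℕ → ℕ} (ha : UnitSteps a) (m : ℕ) :
    ((2 : ℝ) ^ a m)⁻¹ ≤ 2 * ((2 : ℝ) ^ a (m + 1))⁻¹ := by
  have h : (2 : ℝ) ^ a (m + 1) ≤ 2 * 2 ^ a m := by
    rw [← pow_succ']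
    exact pow_le_pow_right₀ one_le_two (by rcases ha m with h | h <;> omega)
  rw [← div_eq_mul_inv, inv_eq_one_div, div_le_div_iff₀ (by positivity) (by positivity)]
  linarith

theorem exists_unitSteps_comparable {w : ℕ → ℝ} (hpos : ∀ m, 0 < w m) (hanti : Antitone w)
    (hdouble : ∀ m, w m ≤ 2 * w (m + 1)) :
    ∃ a, UnitSteps a ∧ ∀ m, w m ≤ w 0 * ((2 : ℝ) ^ a m)⁻¹ ∧ w 0 * ((2 : ℝ) ^ a m)⁻¹ ≤ 2 * w m := by
  have hscale_le (m) : w m / w 0 ≤ 1 := (div_le_one (hpos 0)).2 (hanti m.zero_le)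
  have hscale_pos (m) : 0 < w m / w 0 := div_pos (hpos m) (hpos 0)
  refine ⟨fun m => dyadicScale (w m / w 0), fun m => ?_, fun m => ⟨?_, ?_⟩⟩
  · have hmono := dyadicScale_le_dyadicScale (hscale_pos (m + 1))
      (div_le_div_of_nonneg_right (hanti m.le_succ) (hpos 0).le)
    have hstep : dyadicScale (w (m + 1) / w 0) ≤ dyadicScale (w m / w 0) + 1 :=
      dyadicScale_le_dyadicScale_add_one (hscale_pos m) (hscale_pos (m + 1)) <| by
        rw [← mul_div_assoc]
        exact div_le_div_of_nonneg_right (hdouble m) (hpos 0).le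
    dsimp only
    omega
  · rw [← div_le_iff₀' (hpos 0)]
    exact le_inv_two_pow_dyadicScale (hscale_pos m) (hscale_le m)
  · have := inv_two_pow_dyadicScale_add_one_lt (hscale_pos m)
    rw [pow_succ, mul_inv, lt_div_iff₀' (hpos 0)] at this
    linarith

-- Since the lengths are nonincreasing powers of `1 / 2`, consecutive dyadic intervals with these
-- lengths are aligned: each of them lies in a single dyadic cell of its own length.
theorem floor_two_pow_mul_eq_of_mem_Ico {ι : Type*} [LinearOrder ι] [LocallyFiniteOrderBot ι]
    {p : ι → ℕ} (hp : Monotone p) {n : ι} {x : ℝ}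
    (hx : x ∈ Ico (∑ i ∈ Finset.Iio n, ((2 : ℝ) ^ p i)⁻¹)
      (∑ i ∈ Finset.Iic n, ((2 : ℝ) ^ p i)⁻¹)) :
    ⌊(2 : ℝ) ^ p n * x⌋ = ∑ i ∈ Finset.Iio n, 2 ^ (p n - p i) := by
  have haligned : (2 : ℝ) ^ p n * ∑ i ∈ Finset.Iio n, ((2 : ℝ) ^ p i)⁻¹ =
      (∑ i ∈ Finset.Iio n, 2 ^ (p n - p i) : ℤ) := by
    push_cast
    rw [Finset.mul_sum]
    exact Finset.sum_congr rfl fun i hi =>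
      (pow_sub₀ _ two_ne_zero (hp (Finset.mem_Iio.1 hi).le)).symm
  have hpow : (0 : ℝ) < 2 ^ p n := by positivity
  rw [← Finset.Iio_insert, Finset.sum_insert Finset.notMem_Iio_self] at hx
  rw [Int.floor_eq_iff, ← haligned]
  refine ⟨mul_le_mul_of_nonneg_left hx.1 hpow.le, (mul_lt_mul_of_pos_left hx.2 hpow).trans_eq ?_⟩
  rw [mul_add, mul_inv_cancel₀ hpow.ne', add_comm]

/-! ### Spreading binary digits -/

/-- The `m`-th dyadic numerator of the spreading of `x` along `a`: a binary digit of `x` is placed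
where `a` jumps, and a zero elsewhere. -/
noncomputable def spreadNum (a : ℕ → ℕ) (x : ℝ) : ℕ → ℤ
  | 0 => ⌊(2 : ℝ) ^ a 0 * x⌋
  | m + 1 => 2 * spreadNum a x m +
      (⌊(2 : ℝ) ^ a (m + 1) * x⌋ - 2 ^ (a (m + 1) - a m) * ⌊(2 : ℝ) ^ a m * x⌋)

/-- The spreading of `x` along `a`: the limit of the dyadic rationals with numerators
`spreadNum a x`. The binary digits of `x` are moved to the places where `a` jumps, so dyadic
intervals of length `2 ^ (-a m)` are mapped into dyadic intervals of length `2 ^ (-m)`. -/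
noncomputable def spread (a : ℕ → ℕ) (x : ℝ) : ℝ := ⨆ m, (spreadNum a x m : ℝ) / 2 ^ m

section

variable {a : ℕ → ℕ} (ha : UnitSteps a)
include ha

theorem floor_two_pow_succ_mul (x : ℝ) (m : ℕ) :
    a (m + 1) = a m ∧ ⌊(2 : ℝ) ^ a (m + 1) * x⌋ = ⌊(2 : ℝ) ^ a m * x⌋ ∨
    a (m + 1) = a m + 1 ∧ (⌊(2 : ℝ) ^ a (m + 1) * x⌋ = 2 * ⌊(2 : ℝ) ^ a m * x⌋ ∨
      ⌊(2 : ℝ) ^ a (m + 1) * x⌋ = 2 * ⌊(2 : ℝ) ^ a m * x⌋ + 1) := by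
  rcases ha m with h | h
  · exact Or.inl ⟨h, by rw [h]⟩
  · refine Or.inr ⟨h, ?_⟩
    rw [h, pow_succ', mul_assoc]
    have hlower : 2 * ⌊(2 : ℝ) ^ a m * x⌋ ≤ ⌊2 * ((2 : ℝ) ^ a m * x)⌋ := by
      rw [Int.le_floor]; push_cast; linarith [Int.floor_le ((2 : ℝ) ^ a m * x)]
    have hupper : ⌊2 * ((2 : ℝ) ^ a m * x)⌋ < 2 * ⌊(2 : ℝ) ^ a m * x⌋ + 2 := by
      rw [Int.floor_lt]; push_cast; linarith [Int.lt_floor_add_one ((2 : ℝ) ^ a m * x)]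
    omega

theorem spreadNum_succ_eq_or (x : ℝ) (m : ℕ) :
    spreadNum a x (m + 1) = 2 * spreadNum a x m ∨
      spreadNum a x (m + 1) = 2 * spreadNum a x m + 1 := by
  rcases floor_two_pow_succ_mul ha x m with ⟨h, hx⟩ | ⟨h, hx | hx⟩ <;> rw [h] at hx <;>
    simp only [spreadNum, h, Nat.sub_self, Nat.add_sub_cancel_left, pow_zero, pow_one] <;> omega

theorem spreadNum_congr {x y : ℝ} {m : ℕ} (h : ⌊(2 : ℝ) ^ a m * x⌋ = ⌊(2 : ℝ) ^ a m * y⌋) :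
    spreadNum a x m = spreadNum a y m := by
  induction m with
  | zero => exact h
  | succ m ih =>
    have hprev : ⌊(2 : ℝ) ^ a m * x⌋ = ⌊(2 : ℝ) ^ a m * y⌋ := by
      have := floor_two_pow_succ_mul ha x m
      have := floor_two_pow_succ_mul ha y m
      omega
    simp only [spreadNum, h, hprev, ih hprev]

theorem floor_sub_le_spreadNum_sub {x y : ℝ} (hxy : x ≤ y) (m : ℕ) :
    ⌊(2 : ℝ) ^ a m * y⌋ - ⌊(2 : ℝ) ^ a m * x⌋ ≤ spreadNum a y m - spreadNum a x m := by
  induction m with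
  | zero => exact le_rfl
  | succ m ih =>
    have hm : ⌊(2 : ℝ) ^ a m * x⌋ ≤ ⌊(2 : ℝ) ^ a m * y⌋ := by gcongr
    rcases ha m with h | h <;>
      simp only [spreadNum, h, Nat.sub_self, Nat.add_sub_cancel_left, pow_zero, pow_one] <;> omega

theorem monotone_spreadNum_div (x : ℝ) : Monotone fun m => (spreadNum a x m : ℝ) / 2 ^ m := by
  refine monotone_nat_of_le_succ fun m => ?_
  have h : 2 * (spreadNum a x m : ℝ) ≤ spreadNum a x (m + 1) := by
    exact_mod_cast (by rcases spreadNum_succ_eq_or ha x m with h | h <;> omega :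
      2 * spreadNum a x m ≤ spreadNum a x (m + 1))
  rw [pow_succ', ← div_div]
  gcongr
  linarith

theorem antitone_spreadNum_add_one_div (x : ℝ) :
    Antitone fun m => ((spreadNum a x m : ℝ) + 1) / 2 ^ m := by
  refine antitone_nat_of_succ_le fun m => ?_
  have h : (spreadNum a x (m + 1) : ℝ) ≤ 2 * spreadNum a x m + 1 := by
    exact_mod_cast (by rcases spreadNum_succ_eq_or ha x m with h | h <;> omega :
      spreadNum a x (m + 1) ≤ 2 * spreadNum a x m + 1)
  rw [pow_succ', ← div_div]
  gcongr
  linarith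

theorem spread_mul_two_pow_mem_Icc (x : ℝ) (m : ℕ) :
    spread a x * 2 ^ m ∈ Icc (spreadNum a x m : ℝ) (spreadNum a x m + 1) := by
  have h := (monotone_spreadNum_div ha x).ciSup_mem_iInter_Icc_of_antitone
    (antitone_spreadNum_add_one_div ha x) fun m =>
      div_le_div_of_nonneg_right (by linarith) (by positivity)
  have hm := mem_iInter.1 h m
  rwa [mem_Icc, div_le_iff₀ (by positivity), le_div_iff₀ (by positivity)] at hm

theorem abs_spread_sub_le_of_floor_eq {x y : ℝ} {m : ℕ}
    (h : ⌊(2 : ℝ) ^ a m * x⌋ = ⌊(2 : ℝ) ^ a m * y⌋) :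
    |spread a x - spread a y| ≤ ((2 : ℝ) ^ m)⁻¹ := by
  have hx := spread_mul_two_pow_mem_Icc ha x m
  have hy := spread_mul_two_pow_mem_Icc ha y m
  rw [spreadNum_congr ha h] at hx
  have hpow : (0 : ℝ) < 2 ^ m := by positivity
  rw [← one_div, le_div_iff₀ hpow, ← abs_of_pos hpow, ← abs_mul, sub_mul, abs_le]
  constructor <;> linarith [hx.1, hx.2, hy.1, hy.2]

theorem abs_sub_le_of_abs_spread_sub_le {x y : ℝ} {m : ℕ}
    (h : |spread a x - spread a y| ≤ ((2 : ℝ) ^ m)⁻¹) : |x - y| ≤ 3 * ((2 : ℝ) ^ a m)⁻¹ := by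
  wlog hxy : x ≤ y generalizing x y
  · rw [abs_sub_comm]
    exact this (by rwa [abs_sub_comm]) (le_of_not_ge hxy)
  have hspread : spread a y * 2 ^ m ≤ spread a x * 2 ^ m + 1 := by
    have hpow : (0 : ℝ) < 2 ^ m := by positivity
    rw [← one_div, le_div_iff₀ hpow] at h
    linarith [mul_le_mul_of_nonneg_right (neg_le_abs (spread a x - spread a y)) hpow.le]
  have hnum : (spreadNum a y m : ℝ) ≤ spreadNum a x m + 2 := by
    linarith [(spread_mul_two_pow_mem_Icc ha y m).1, (spread_mul_two_pow_mem_Icc ha x m).2]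
  have hfloor : (⌊(2 : ℝ) ^ a m * y⌋ - ⌊(2 : ℝ) ^ a m * x⌋ : ℝ) ≤
      spreadNum a y m - spreadNum a x m := by
    exact_mod_cast floor_sub_le_spreadNum_sub ha hxy m
  rw [abs_sub_comm, abs_of_nonneg (sub_nonneg.2 hxy), ← div_eq_mul_inv,
    le_div_iff₀ (by positivity)]
  linarith [Int.floor_le ((2 : ℝ) ^ a m * x), Int.lt_floor_add_one ((2 : ℝ) ^ a m * y)]

theorem ediam_spread_image_le {E : Set ℝ} {m : ℕ} {z : ℤ}
    (hE : ∀ x ∈ E, ⌊(2 : ℝ) ^ a m * x⌋ = z) :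
    Metric.ediam (spread a '' E) ≤ ENNReal.ofReal ((2 : ℝ) ^ m)⁻¹ := by
  apply Metric.ediam_le
  rintro _ ⟨x, hx, rfl⟩ _ ⟨y, hy, rfl⟩
  rw [edist_dist, Real.dist_eq]
  exact ENNReal.ofReal_le_ofReal
    (abs_spread_sub_le_of_floor_eq ha ((hE x hx).trans (hE y hy).symm))

theorem volume_preimage_spread_le {E : Set ℝ} {m : ℕ}
    (hE : Metric.ediam E ≤ ENNReal.ofReal ((2 : ℝ) ^ m)⁻¹) :
    volume (spread a ⁻¹' E) ≤ ENNReal.ofReal (3 * ((2 : ℝ) ^ a m)⁻¹) := by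
  refine (Real.volume_le_diam _).trans (Metric.ediam_le fun x hx y hy => ?_)
  have hxy := (Metric.edist_le_ediam_of_mem (mem_preimage.1 hx) (mem_preimage.1 hy)).trans hE
  rw [edist_dist, Real.dist_eq, ENNReal.ofReal_le_ofReal_iff (by positivity)] at hxy ⊢
  exact abs_sub_le_of_abs_spread_sub_le ha hxy

theorem isDominated_spread_image_Ici {s : ℕ+ → ℝ} (hs : Antitone s) (hpos : ∀ n, 0 < s n)
    (hns : ¬ Summable fun n => ((2 : ℝ) ^ a (dyadicScale (s n)))⁻¹) :
    IsDominated (mulClosure {s}) (spread a '' Ici 0) := by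
  rintro _ ⟨s, rfl, k, rfl⟩
  have hscale : Monotone fun n => dyadicScale (s n) := fun _ _ hmn =>
    dyadicScale_le_dyadicScale (hpos _) (hs hmn)
  let p (n : ℕ+) : ℕ := a (dyadicScale (mulShift s k n) + 1)
  have hp : Monotone p := fun _ _ hmn =>
    ha.monotone (Nat.succ_le_succ (hscale (mul_le_mul_right hmn k)))
  have hns' : ¬ Summable fun n => ((2 : ℝ) ^ p n)⁻¹ := fun h =>
    hns <| summable_of_summable_mul_left
      (fun _ _ hmn => inv_anti₀ (by positivity)
        (pow_le_pow_right₀ one_le_two (ha.monotone (hscale hmn)))) k <|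
      .of_nonneg_of_le (fun n => by positivity) (fun n => ha.inv_two_pow_le _) (h.mul_left 2)
  refine exists_isFine_cover_image_Ici (fun n => by positivity) hns' fun n => ?_
  refine (ediam_spread_image_le ha fun x hx => floor_two_pow_mul_eq_of_mem_Ico hp hx).trans_lt ?_
  exact (ENNReal.ofReal_lt_ofReal_iff (hpos _)).2 (inv_two_pow_dyadicScale_add_one_lt (hpos _))

-- Lebesgue measure pushed forward by the spreading gives a set of diameter about `s n` measure of
-- order `2 ^ (-a (dyadicScale (s n)))`.
theorem volume_eq_zero_of_isDominated_spread_image {s : ℕ+ → ℝ}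
    (hsum : Summable fun n => ((2 : ℝ) ^ a (dyadicScale (s n)))⁻¹) {B : Set ℝ}
    (hB : IsDominated (mulClosure {s}) (spread a '' B)) : volume B = 0 := by
  refine measure_mono_null (subset_preimage_image (spread a) B) <|
    hB.outerMeasure_eq_zero (OuterMeasure.map (spread a) (volume : Measure ℝ).toOuterMeasure)
      (hsum.mul_left 3).tsum_ofReal_ne_top ?_
  filter_upwards [eventually_le_one_of_summable_dyadicScale (g := fun m => ((2 : ℝ) ^ a m)⁻¹)
    (by positivity) hsum] with n hn E hE
  have hpos : 0 < s n := ENNReal.ofReal_pos.1 (zero_le.trans_lt hE)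
  exact volume_preimage_spread_le ha <|
    hE.le.trans (ENNReal.ofReal_le_ofReal (le_inv_two_pow_dyadicScale hpos hn))

theorem le_dimH_spread_image_Ico {β C : ℝ≥0} (hβ : 0 < β)
    (h : ∀ m, ((2 : ℝ) ^ a m)⁻¹ ≤ C * ((2 : ℝ) ^ m)⁻¹ ^ (β : ℝ)) :
    β ≤ dimH (spread a '' Ico 0 1) := by
  have hholder : ∀ x ∈ Ico (0 : ℝ) 1, ∀ y ∈ Ico (0 : ℝ) 1,
      edist x y ≤ (3 * C * 2 ^ (β : ℝ) + 1 : ℝ≥0) * edist (spread a x) (spread a y) ^ (β : ℝ) := by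
    intro x hx y hy
    have hreal : |x - y| ≤
        ((3 * C : ℝ≥0) * 2 ^ (β : ℝ) + 1) * |spread a x - spread a y| ^ (β : ℝ) := by
      refine le_mul_rpow_of_forall_dyadic hβ (abs_nonneg _)
        (abs_le.2 ⟨by linarith [hx.1, hy.2], by linarith [hx.2, hy.1]⟩) fun m hm => ?_
      refine (abs_sub_le_of_abs_spread_sub_le ha hm).trans ?_
      push_cast
      linarith [h m]
    rw [edist_dist, edist_dist, Real.dist_eq, Real.dist_eq,
      ENNReal.ofReal_rpow_of_nonneg (abs_nonneg _) β.coe_nonneg, ← ENNReal.ofReal_coe_nnreal,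
      ← ENNReal.ofReal_mul NNReal.zero_le_coe]
    exact ENNReal.ofReal_le_ofReal (by exact_mod_cast hreal)
  have hdim := dimH_le_dimH_image_div hβ hholder
  rw [Real.dimH_of_nonempty_interior (by simp [interior_Ico])] at hdim
  rwa [Module.finrank_self, Nat.cast_one, ENNReal.le_div_iff_mul_le (by simp [hβ.ne']) (by simp),
    one_mul] at hdim

theorem dimH_spread_image_Ico_le {γ C : ℝ≥0}
    (h : ∀ m, ((2 : ℝ) ^ m)⁻¹ ^ (γ : ℝ) ≤ C * ((2 : ℝ) ^ a m)⁻¹) :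
    dimH (spread a '' Ico 0 1) ≤ γ := by
  have hlim : Tendsto (fun m : ℕ => ENNReal.ofReal ((2 : ℝ) ^ m)⁻¹) atTop (𝓝 0) := by
    simp_rw [← ENNReal.ofReal_zero, ← inv_pow]
    exact ENNReal.tendsto_ofReal (tendsto_pow_atTop_nhds_zero_of_lt_one (by norm_num) (by norm_num))
  refine dimH_le_of_forall_finite_cover (ι := fun m => Fin (2 ^ a m)) (C := C)
    (t := fun m i => spread a '' {x | ⌊(2 : ℝ) ^ a m * x⌋ = (i : ℕ)}) hlim
    (fun m i => ediam_spread_image_le ha fun _ hx => hx) (fun m => ?_) fun m => ?_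
  · rintro _ ⟨x, ⟨hx0, hx1⟩, rfl⟩
    have hfloor : ⌊(2 : ℝ) ^ a m * x⌋ < ((2 ^ a m : ℕ) : ℤ) := by
      rw [Int.floor_lt]
      push_cast
      exact mul_lt_of_lt_one_right (by positivity) hx1
    obtain ⟨i, hi⟩ := Int.eq_ofNat_of_zero_le (Int.floor_nonneg.2 (by positivity :
      0 ≤ (2 : ℝ) ^ a m * x))
    exact mem_iUnion.2 ⟨⟨i, by omega⟩, x, hi, rfl⟩
  · have hreal : (2 : ℝ) ^ a m * ((2 : ℝ) ^ m)⁻¹ ^ (γ : ℝ) ≤ C := by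
      rw [← le_inv_mul_iff₀ (by positivity), mul_comm _ (C : ℝ)]
      exact h m
    rw [ENNReal.ofReal_rpow_of_nonneg (by positivity) γ.coe_nonneg, Fintype.card_fin,
      ← ENNReal.ofReal_natCast, ← ENNReal.ofReal_mul (Nat.cast_nonneg _),
      ← ENNReal.ofReal_coe_nnreal]
    exact ENNReal.ofReal_le_ofReal (by exact_mod_cast hreal)

end

/-! ### Summability of powers -/

theorem exists_isDominated_le_dimH {s : ℕ+ → ℝ} (hs : Antitone s) (hpos : ∀ n, 0 < s n) {β : ℝ≥0}
    (hβ : 0 < β) (hβ1 : β ≤ 1) (hns : ¬ Summable fun n => s n ^ (β : ℝ)) :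
    ∃ A : Set ℝ, IsDominated (mulClosure {s}) A ∧ β ≤ dimH A := by
  obtain ⟨a, ha, hw⟩ := exists_unitSteps_comparable (w := fun m => ((2 : ℝ) ^ m)⁻¹ ^ (β : ℝ))
    (fun m => by positivity) (inv_two_pow_rpow_antitone β.coe_nonneg)
    (inv_two_pow_rpow_le_two_mul hβ1)
  simp only [pow_zero, inv_one, Real.one_rpow, one_mul] at hw
  have hns' : ¬ Summable fun n => ((2 : ℝ) ^ a (dyadicScale (s n)))⁻¹ := fun h =>
    hns <| (summable_rpow_dyadicScale_iff hpos β.coe_nonneg).1 <|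
      .of_nonneg_of_le (fun n => by positivity) (fun n => (hw _).1) h
  exact ⟨spread a '' Ici 0, isDominated_spread_image_Ici ha hs hpos hns',
    (le_dimH_spread_image_Ico ha (C := 2) hβ fun m => (hw m).2).trans
      (dimH_mono (image_mono Ico_subset_Ici_self))⟩

theorem exists_unitSteps_comparable_tsum_rpow {ι : Type*} [Nonempty ι] {c β : ι → ℝ}
    (hc : ∀ j, 0 < c j) (hsum : Summable c) (hβ0 : ∀ j, 0 ≤ β j) (hβ1 : ∀ j, β j ≤ 1) :
    ∃ a, UnitSteps a ∧ (∀ j, ∃ C : ℝ≥0, ∀ m, ((2 : ℝ) ^ m)⁻¹ ^ β j ≤ C * ((2 : ℝ) ^ a m)⁻¹) ∧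
      ∃ C : ℝ, ∀ m, ((2 : ℝ) ^ a m)⁻¹ ≤ C * ∑' j, c j * ((2 : ℝ) ^ m)⁻¹ ^ β j := by
  let w (m : ℕ) : ℝ := ∑' j, c j * ((2 : ℝ) ^ m)⁻¹ ^ β j
  have hterm (m) (j) : 0 < c j * ((2 : ℝ) ^ m)⁻¹ ^ β j := mul_pos (hc j) (by positivity)
  have hw (m) : Summable fun j => c j * ((2 : ℝ) ^ m)⁻¹ ^ β j :=
    .of_nonneg_of_le (fun j => (hterm m j).le) (fun j => mul_le_of_le_one_right (hc j).le
      (by simpa using inv_two_pow_rpow_antitone (hβ0 j) m.zero_le)) hsum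
  have hterm_le (m) (j) : c j * ((2 : ℝ) ^ m)⁻¹ ^ β j ≤ w m :=
    (hw m).le_tsum j fun i _ => (hterm m i).le
  have hpos (m) : 0 < w m := (hterm m (Classical.arbitrary ι)).trans_le (hterm_le m _)
  have hanti : Antitone w := fun m n hmn => (hw n).tsum_le_tsum
    (fun j => mul_le_mul_of_nonneg_left (inv_two_pow_rpow_antitone (hβ0 j) hmn) (hc j).le) (hw m)
  have hdouble (m) : w m ≤ 2 * w (m + 1) := by
    rw [← tsum_mul_left]
    refine (hw m).tsum_le_tsum (fun j => ?_) ((hw (m + 1)).mul_left 2)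
    rw [mul_left_comm]
    exact mul_le_mul_of_nonneg_left (inv_two_pow_rpow_le_two_mul (hβ1 j) m) (hc j).le
  obtain ⟨a, ha, haw⟩ := exists_unitSteps_comparable hpos hanti hdouble
  refine ⟨a, ha, fun j => ⟨(w 0 / c j).toNNReal, fun m => ?_⟩, 2 / w 0, fun m => ?_⟩
  · rw [Real.coe_toNNReal _ (div_pos (hpos 0) (hc j)).le, div_mul_eq_mul_div, le_div_iff₀' (hc j)]
    exact (hterm_le m j).trans (haw m).1
  · rw [div_mul_eq_mul_div, le_div_iff₀' (hpos 0)]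
    exact (haw m).2

theorem exists_forall_dimH_le_not_isDominated {s : ℕ+ → ℝ} (hpos : ∀ n, 0 < s n) {β : ℕ → ℝ≥0}
    (hβ1 : ∀ j, β j ≤ 1) (hsum : ∀ j, Summable fun n => s n ^ (β j : ℝ)) :
    ∃ A : Set ℝ, (∀ j, dimH A ≤ β j) ∧ ¬ IsDominated (mulClosure {s}) A := by
  obtain ⟨c, hc, hcsum, hprod⟩ := exists_pos_summable_mul_prod
    (f := fun j n => ((2 : ℝ) ^ dyadicScale (s n))⁻¹ ^ (β j : ℝ)) (fun j n => by positivity)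
    fun j => (summable_rpow_dyadicScale_iff hpos (β j).coe_nonneg).2 (hsum j)
  obtain ⟨a, ha, hdim, C, hC⟩ := exists_unitSteps_comparable_tsum_rpow hc hcsum
    (fun j => (β j).coe_nonneg) hβ1
  have hasum : Summable fun n => ((2 : ℝ) ^ a (dyadicScale (s n)))⁻¹ :=
    .of_nonneg_of_le (fun n => by positivity) (fun n => hC _) (hprod.prod_symm.prod.mul_left C)
  refine ⟨spread a '' Ico 0 1, fun j => (hdim j).elim fun _ => dimH_spread_image_Ico_le ha,
    fun hdom => ?_⟩
  simpa using volume_eq_zero_of_isDominated_spread_image ha hasum hdom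

theorem exists_dimH_le_not_isDominated {s : ℕ+ → ℝ} (hpos : ∀ n, 0 < s n) {α : ℝ≥0} (hα : α < 1)
    (hsum : ∀ β : ℝ≥0, α < β → β ≤ 1 → Summable fun n => s n ^ (β : ℝ)) :
    ∃ A : Set ℝ, dimH A ≤ α ∧ ¬ IsDominated (mulClosure {s}) A := by
  obtain ⟨β, -, hβ, hlim⟩ := exists_seq_strictAnti_tendsto' hα
  obtain ⟨A, hA, hndom⟩ := exists_forall_dimH_le_not_isDominated hpos (fun j => (hβ j).2.le)
    fun j => hsum (β j) (hβ j).1 (hβ j).2.le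
  exact ⟨A, ge_of_tendsto' (ENNReal.tendsto_coe.2 hlim) hA, hndom⟩

theorem hausdorffDimLE_ne_dominatedSets {s : ℕ+ → ℝ} (hs : Antitone s) (hpos : ∀ n, 0 < s n)
    {α : ℝ≥0} (hα : α < 1) : hausdorffDimLE α ≠ dominatedSets ℝ (mulClosure {s}) := by
  intro heq
  by_cases hsum : ∀ β : ℝ≥0, α < β → β ≤ 1 → Summable fun n => s n ^ (β : ℝ)
  · obtain ⟨A, hA, hndom⟩ := exists_dimH_le_not_isDominated hpos hα hsum
    exact hndom (heq.subset hA)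
  · push Not at hsum
    obtain ⟨β, hαβ, hβ1, hns⟩ := hsum
    obtain ⟨A, hdom, hA⟩ := exists_isDominated_le_dimH hs hpos (pos_of_gt hαβ) hβ1 hns
    exact (hA.trans (heq.superset hdom)).not_gt (ENNReal.coe_lt_coe.2 hαβ)

theorem hausdorffDimLE_one : hausdorffDimLE 1 = univ :=
  eq_univ_of_forall fun A => (dimH_mono (subset_univ A)).trans (by simp [Real.dimH_univ])

theorem dominatedSets_eq_univ_iff {s : ℕ+ → ℝ} (hs : Antitone s) (hpos : ∀ n, 0 < s n) :
    dominatedSets ℝ (mulClosure {s}) = univ ↔ ¬ Summable s := by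
  refine ⟨fun h hsum => ?_, fun hns => eq_univ_of_forall (isDominated_of_not_summable hs hpos hns)⟩
  simpa using volume_eq_zero_of_isDominated hsum (h.superset (mem_univ univ))

end Dominated

theorem mainTheorem7_general {s : ℕ+ → ℝ} (hs : Antitone s) (hpos : ∀ n, 0 < s n) :
    (∀ α : ℝ≥0, α < 1 →
      Dominated.hausdorffDimLE α ≠ Dominated.dominatedSets ℝ (Dominated.mulClosure {s})) ∧
    (Dominated.hausdorffDimLE 1 ≠ Dominated.dominatedSets ℝ (Dominated.mulClosure {s}) ↔
      Memℓp s 1) := by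
  refine ⟨fun α hα => Dominated.hausdorffDimLE_ne_dominatedSets hs hpos hα, ?_⟩
  have hmem : Memℓp s 1 ↔ Summable s := by
    rw [memℓp_gen_iff (by simp)]
    simp [abs_of_pos (hpos _)]
  rw [Dominated.hausdorffDimLE_one, hmem, ne_comm, Ne, Dominated.dominatedSets_eq_univ_iff hs hpos,
    not_not]

theorem mainTheorem7 :
    (∀ s ∈ Dominated.decSeq, ∀ α : ℝ≥0, α < 1 →
      Dominated.hausdorffDimLE α ≠ Dominated.dominatedSets ℝ (Dominated.mulClosure {s})) ∧
    (∀ s ∈ Dominated.decSeq,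
      (Dominated.hausdorffDimLE 1 ≠ Dominated.dominatedSets ℝ (Dominated.mulClosure {s}) ↔
        Memℓp s 1)) :=
  ⟨fun _ hs => (mainTheorem7_general hs.1.antitone hs.2.1).1,
    fun _ hs => (mainTheorem7_general hs.1.antitone hs.2.1).2⟩
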